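/- Let $\Gamma$ be a finite undirected simple graph. Let $\mathsf{Acyc}(\Gamma)$ be the set of acyclic orientations of $\Gamma$. A \emph{click} converts a source of an acyclic orientation into a sink by reversing all edges at that source. Clicks generate an equivalence relation $\sim_\kappa$ on $\mathsf{Acyc}(\Gamma)$. Let $\kappa(\Gamma)$ be the number of its equivalence classes. For an edge $e$ let $\Gamma'_e$ be the graph obtained by deleting $e$, and let $\Gamma''_e$ be the simple graph obtained by contracting $e$ (parallel edges being merged). A \emph{cycle-edge} is an edge that is not a bridge. Then, for every edge $e=\{v,w\}$ of $\Gamma$: (i) If $e$ is a bridge linking $\Gamma_1$ and $\Gamma_2$, i.e. $\Gamma'_e$ is the disjoint union of subgraphs $\Gamma_1\ni v$ and $\Gamma_2\ni w$ with no edge between them (if $\Gamma$ is connected, these are the two connected components of $\Gamma'_e$), then $\kappa(\Gamma)=\kappa(\Gamma_1)\,\kappa(\Gamma_2)$. (ii) If $e$ is a cycle-edge, then $\kappa(\Gamma)=\kappa(\Gamma'_e)+\kappa(\Gamma''_e)$. Moreover, $\kappa(\Gamma)=T_\Gamma(1,0)$, where $$T_\Gamma(x,y)=\sum_{A\subseteq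 E}(x-1)^{r(E)-r(A)}(y-1)^{|A|-r(A)}$$ is the Tutte polynomial of $\Gamma$; here $E$ is the edge set of $\Gamma$, and $r(A)$ is the number of vertices minus the number of connected components of the spanning subgraph with edge set $A$. -/

import Mathlib

noncomputable section

namespace SimpleGraph

variable {V : Type*}

/-- An orientation of a simple graph `Γ`, viewed as a directed graph: `O.Dir i j` says that
`{i, j}` is an edge of `Γ` which is oriented as `(i, j)`. -/
@[ext]
structure EdgeOrientation (Γ : SimpleGraph V) where
  /-- `Dir i j`: the edge `{i, j}` is oriented from `i` to `j`. -/
  Dir : V → V → Prop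
  /-- Only edges of `Γ` are oriented. -/
  adj_of_dir : ∀ i j, Dir i j → Γ.Adj i j
  /-- Every edge of `Γ` is oriented in exactly one of its two directions. -/
  xor_of_adj : ∀ i j, Γ.Adj i j → Xor (Dir i j) (Dir j i)

namespace EdgeOrientation

variable {Γ : SimpleGraph V}

/-- An orientation is acyclic if it has no directed cycle, that is, no directed path with at
least one edge leads from a vertex back to itself. -/
def IsAcyclic (O : Γ.EdgeOrientation) : Prop :=
  ∀ v, ¬ Relation.TransGen O.Dir v v

/-- A source is a vertex without incoming edges. -/
def IsSource (O : Γ.EdgeOrientation) (v : V) : Prop :=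
  ∀ i, ¬ O.Dir i v

/-- The orientation obtained by reversing all edges at the vertex `v`. It turns a source `v`
into a sink. -/
def reverseAt (O : Γ.EdgeOrientation) (v : V) : Γ.EdgeOrientation where
  Dir i j := ((i = v ∨ j = v) ∧ O.Dir j i) ∨ (¬ (i = v ∨ j = v) ∧ O.Dir i j)
  adj_of_dir := by
    rintro i j (⟨_, h⟩ | ⟨_, h⟩)
    · exact (O.adj_of_dir j i h).symm
    · exact O.adj_of_dir i j h
  xor_of_adj := by
    intro i j h
    have := O.xor_of_adj i j h
    unfold Xor at *
    tauto

end EdgeOrientation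

/-- The set of acyclic orientations of `Γ`. -/
def Acyc (Γ : SimpleGraph V) : Type _ :=
  {O : Γ.EdgeOrientation // O.IsAcyclic}

/-- `O'` arises from `O` by a click (source-to-sink operation): the conversion of one source
of `O` into a sink. -/
def Click {Γ : SimpleGraph V} (O O' : Γ.Acyc) : Prop :=
  ∃ v, O.1.IsSource v ∧ O'.1 = O.1.reverseAt v

/-- `κ`-equivalence: the equivalence relation on acyclic orientations generated by clicks. -/
def kappaSetoid (Γ : SimpleGraph V) : Setoid Γ.Acyc :=
  Relation.EqvGen.setoid Click

/-- The number `κ(Γ)` of `κ`-classes of acyclic orientations of `Γ`. -/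
def kappa (Γ : SimpleGraph V) : ℕ :=
  Nat.card (Quotient Γ.kappaSetoid)

/-- The vertices of the contraction of `e`: the vertices of the graph, with the ends of `e`
identified. -/
abbrev ContractVert (e : Sym2 V) : Type _ :=
  Quot fun x y : V => s(x, y) = e

/-- The contraction of the edge `e`: the ends of `e` are identified; the loop which `e` becomes
is dropped and parallel edges are merged, as in `SimpleGraph.map`. -/
def contractEdge (Γ : SimpleGraph V) (e : Sym2 V) : SimpleGraph (ContractVert e) :=
  Γ.map (Quot.mk _)

/-- A cycle-edge is an edge which is not a bridge. -/
def IsCycleEdge (Γ : SimpleGraph V) (e : Sym2 V) : Prop :=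
  e ∈ Γ.edgeSet ∧ ¬ Γ.IsBridge e

/-- The rank of a set `A` of edges on the vertex set `V`: the number of vertices minus the number
of connected components of the spanning graph with edge set `A`. -/
def edgeRank (A : Set (Sym2 V)) : ℕ :=
  Nat.card V - Nat.card (fromEdgeSet A).ConnectedComponent

/-- The Tutte polynomial
`T_Γ(x, y) = ∑_{A ⊆ E} (x - 1) ^ (r(E) - r(A)) * (y - 1) ^ (|A| - r(A))`,
with `x = X 0` and `y = X 1`. -/
def tuttePolynomial [Finite V] (Γ : SimpleGraph V) : MvPolynomial (Fin 2) ℤ :=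
  ∑ A ∈ (Set.toFinite Γ.edgeSet).toFinset.powerset,
    (MvPolynomial.X 0 - 1) ^ (edgeRank Γ.edgeSet - edgeRank (A : Set (Sym2 V))) *
      (MvPolynomial.X 1 - 1) ^ (A.card - edgeRank (A : Set (Sym2 V)))

end SimpleGraph

end

/-! Let `R` contain exactly one vertex of each component. Every `κ`-class contains exactly one
acyclic orientation whose set of sources is `R`. For uniqueness, a sequence of clicks changes the
indicator of `i → j` by `f j - f i`, where `f` counts the clicks. After normalising `f` to vanish on
`R`, a maximum principle forces `f = 0`. For existence, clicking sources outside `R` must stop,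
since `f` changes by at most one along an edge and vanishes on `R`. Hence `κ(Γ) = a(Γ, R)`, the
number of these orientations (`kappa_eq_ncard_rootedAcyc`).

Now let `R` be arbitrary and `vw` an edge with `v ∈ R`, `w ∉ R`. Then `a(Γ, R) = a(Γ', R) + a(Γ', R
∪ {w})` with `Γ' = Γ - vw` (`ncard_rootedAcyc_eq_add`). If `vw` is a bridge, the first summand
vanishes and the second is `κ(Γ')`, which factors over a disjoint union. If `vw` is a cycle-edge,
the first summand is `κ(Γ')`, and identifying the roots `v` and `w` turns the second into `κ(Γ'')`.

Up to the sign `(-1)^|Rᶜ|`, the sum of `(-1)^|A|` over the edge sets `A` joining every vertex to `R`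
obeys the same recursion. For a transversal `R` this sum is the Tutte polynomial at `(1, 0)`, where
`0^(r(E) - r(A))` keeps exactly the `A` of full rank. -/

open Relation

namespace SimpleGraph

/-! ### Acyclic orientations and height functions. -/

namespace EdgeOrientation

variable {V : Type*} {Γ : SimpleGraph V}

theorem dir_asymm (O : Γ.EdgeOrientation) {i j : V} (h : O.Dir i j) : ¬ O.Dir j i := by
  have := O.xor_of_adj i j (O.adj_of_dir i j h)
  unfold Xor at this
  tauto

theorem dir_or_dir (O : Γ.EdgeOrientation) {i j : V} (h : Γ.Adj i j) : O.Dir i j ∨ O.Dir j i := by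
  have := O.xor_of_adj i j h
  unfold Xor at this
  tauto

theorem ext_of_le {O O' : Γ.EdgeOrientation} (h : ∀ i j, O.Dir i j → O'.Dir i j) : O = O' := by
  ext i j
  refine ⟨h i j, fun hij => ?_⟩
  rcases O.dir_or_dir (O'.adj_of_dir i j hij) with h1 | h1
  · exact h1
  · exact absurd (h j i h1) (O'.dir_asymm hij)

/-- An orientation along which some height function strictly increases is acyclic. -/
theorem isAcyclic_of_height {O : Γ.EdgeOrientation} (h : V → ℕ)
    (hh : ∀ i j, O.Dir i j → h i < h j) : O.IsAcyclic := by
  intro v hv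
  have key : ∀ w, TransGen O.Dir v w → h v < h w := by
    intro w hw
    induction hw with
    | single h1 => exact hh _ _ h1
    | tail _ h1 ih => exact ih.trans (hh _ _ h1)
  exact lt_irrefl _ (key v hv)

theorem IsAcyclic.of_forall_dir {W : Type*} {Δ : SimpleGraph W} {O : Γ.EdgeOrientation}
    {O' : Δ.EdgeOrientation} (hO' : O'.IsAcyclic) (f : V → W)
    (hf : ∀ i j, O.Dir i j → O'.Dir (f i) (f j)) : O.IsAcyclic :=
  fun v hv => hO' (f v) (TransGen.lift f hf _ _ hv)

theorem IsAcyclic.exists_height [Finite V] {O : Γ.EdgeOrientation} (hO : O.IsAcyclic) :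
    ∃ h : V → ℕ, ∀ i j, O.Dir i j → h i < h j := by
  -- The height counts strict ancestors: `i` is one of `j`, but not of itself.
  refine ⟨fun v => {x | TransGen O.Dir x v}.ncard, fun i j hij => ?_⟩
  have hsub : {x | TransGen O.Dir x i} ⊆ {x | TransGen O.Dir x j} := fun x hx => hx.tail hij
  exact Set.ncard_lt_ncard ((Set.ssubset_iff_of_subset hsub).2 ⟨i, .single hij, hO i⟩)
    (Set.toFinite _)

theorem IsAcyclic.exists_forall_not_dir [Finite V] {O : Γ.EdgeOrientation} (hO : O.IsAcyclic)
    {M : Set V} (hM : M.Nonempty) : ∃ m ∈ M, ∀ i ∈ M, ¬ O.Dir i m := by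
  obtain ⟨h, hh⟩ := hO.exists_height
  obtain ⟨m, hm, hmin⟩ := Set.exists_min_image M h (Set.toFinite _) hM
  exact ⟨m, hm, fun i hi hd => absurd (hh i m hd) (not_lt.2 (hmin i hi))⟩

instance [Finite V] : Finite Γ.EdgeOrientation :=
  Finite.of_injective (fun O : Γ.EdgeOrientation => O.Dir) fun _ _ h => EdgeOrientation.ext h

/-- After the click `v` has no outgoing edge, so a directed path either ends at `v` or never meets
`v` after its start and was already directed before. -/
theorem IsAcyclic.reverseAt {O : Γ.EdgeOrientation} (hO : O.IsAcyclic) {v : V}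
    (hv : O.IsSource v) : (O.reverseAt v).IsAcyclic := by
  have hout : ∀ j, ¬ (O.reverseAt v).Dir v j := by
    rintro j (⟨_, h⟩ | ⟨h, _⟩)
    · exact hv j h
    · exact h (Or.inl rfl)
  have key : ∀ a b, TransGen (O.reverseAt v).Dir a b → b = v ∨ TransGen O.Dir a b := by
    intro a b hab
    induction hab with
    | @single b h =>
      rcases h with ⟨h1 | h1, h⟩ | ⟨_, h⟩
      · exact absurd (h1 ▸ h) (hv _)
      · exact Or.inl h1
      · exact Or.inr (.single h)
    | @tail b c _ h ih =>
      rcases ih with rfl | ih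
      · exact absurd h (hout _)
      · rcases h with ⟨h1 | h1, h⟩ | ⟨_, h⟩
        · exact absurd (h1 ▸ h) (hv _)
        · exact Or.inl h1
        · exact Or.inr (ih.tail h)
  intro a ha
  rcases key a a ha with rfl | h
  · obtain ⟨b, hb, _⟩ := (TransGen.head'_iff.1 ha)
    exact hout _ hb
  · exact hO a h

/-! ### Clicks as shifts by integer-valued functions. -/

open Classical in
/-- The indicator of the orientation of a pair of vertices. -/
noncomputable def indicator (O : Γ.EdgeOrientation) (i j : V) : ℤ := if O.Dir i j then 1 else 0

theorem indicator_of_dir {O : Γ.EdgeOrientation} {i j : V} (h : O.Dir i j) :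
    O.indicator i j = 1 := if_pos h

theorem indicator_of_not_dir {O : Γ.EdgeOrientation} {i j : V} (h : ¬ O.Dir i j) :
    O.indicator i j = 0 := if_neg h

theorem indicator_nonneg (O : Γ.EdgeOrientation) (i j : V) : 0 ≤ O.indicator i j := by
  unfold indicator; split_ifs <;> norm_num

theorem indicator_le_one (O : Γ.EdgeOrientation) (i j : V) : O.indicator i j ≤ 1 := by
  unfold indicator; split_ifs <;> norm_num

/-- `O'` arises from `O` by a shift by `f`: the effect of clicking each vertex `v` a net number
of `f v` times. -/
def IsShift (O O' : Γ.EdgeOrientation) (f : V → ℤ) : Prop :=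
  ∀ i j, Γ.Adj i j → O'.indicator i j = O.indicator i j - f i + f j

theorem IsShift.refl (O : Γ.EdgeOrientation) : IsShift O O 0 := fun i j _ => by simp

theorem IsShift.symm {O O' : Γ.EdgeOrientation} {f : V → ℤ} (h : IsShift O O' f) :
    IsShift O' O (-f) := fun i j hij => by
  have := h i j hij
  simp only [Pi.neg_apply]
  linarith

theorem IsShift.trans {O O' O'' : Γ.EdgeOrientation} {f g : V → ℤ} (h : IsShift O O' f)
    (h' : IsShift O' O'' g) : IsShift O O'' (f + g) := fun i j hij => by
  have := h i j hij
  have := h' i j hij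
  simp only [Pi.add_apply]
  linarith

open Classical in
theorem IsSource.isShift {O : Γ.EdgeOrientation} {v : V} (hv : O.IsSource v) :
    IsShift O (O.reverseAt v) (Pi.single v 1) := by
  intro i j hij
  have hd : (O.reverseAt v).Dir i j ↔
    ((i = v ∨ j = v) ∧ O.Dir j i) ∨ (¬ (i = v ∨ j = v) ∧ O.Dir i j) := Iff.rfl
  have hne := hij.ne
  unfold indicator
  by_cases hi : i = v
  · subst hi
    have h1 : O.Dir i j := (O.dir_or_dir hij).resolve_right (hv j)
    have h2 := hv j
    simp [hd, h1, h2, hne.symm]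
  · by_cases hj : j = v
    · subst hj
      have h1 : O.Dir j i := (O.dir_or_dir hij).resolve_left (hv i)
      have h2 := hv i
      simp [hd, h1, h2, hi]
    · simp [hd, hi, hj]

theorem IsShift.eq_of_eq_zero {O O' : Γ.EdgeOrientation} {f : V → ℤ} (h : IsShift O O' f)
    (hf : ∀ v, f v = 0) : O = O' := by
  refine ext_of_le fun i j hij => by_contra fun hn => ?_
  have := h i j (O.adj_of_dir i j hij)
  rw [indicator_of_dir hij, indicator_of_not_dir hn, hf, hf] at this
  norm_num at this

/-- A maximum principle. Take `s` minimal for `O` among the maximum points of `f`. An edge `i → s`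
would have `f i < f s`, hence indicator at least `2` in `O'`. So `s` is a source, and the maximum is
`0`. -/
theorem IsShift.nonpos [Finite V] {O O' : Γ.EdgeOrientation} {f : V → ℤ} (h : IsShift O O' f)
    (hO : O.IsAcyclic) (hf : ∀ v, O.IsSource v → f v = 0) (v : V) : f v ≤ 0 := by
  by_contra! hpos
  obtain ⟨m, -, hm⟩ := Set.exists_max_image Set.univ f (Set.toFinite _) ⟨v, trivial⟩
  obtain ⟨s, hs, hs'⟩ := hO.exists_forall_not_dir (M := {x | f x = f m}) ⟨m, rfl⟩
  have hsrc : O.IsSource s := by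
    intro i hi
    have hlt : f i < f s := by
      rw [hs.out]
      exact lt_of_le_of_ne (hm i trivial) fun he => hs' i he hi
    have h1 := h i s (O.adj_of_dir _ _ hi)
    have h2 := O'.indicator_le_one i s
    rw [indicator_of_dir hi] at h1
    linarith
  have := hf s hsrc
  have := hm v trivial
  rw [hs.out] at *
  linarith

end EdgeOrientation

/-! ### Transversals and normal forms of `κ`-classes. -/

open EdgeOrientation

variable {V : Type*}

/-- Every vertex is reachable from `R`, that is, `R` meets every connected component. -/
def Spans (Γ : SimpleGraph V) (R : Set V) : Prop :=
  ∀ u, ∃ r ∈ R, Γ.Reachable u r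

/-- `R` contains exactly one vertex of each connected component. -/
structure IsTransversal (Γ : SimpleGraph V) (R : Set V) : Prop where
  spans : Γ.Spans R
  eq_of_reachable : ∀ r ∈ R, ∀ r' ∈ R, Γ.Reachable r r' → r = r'

/-- The acyclic orientations whose set of sources is `R`. -/
def rootedAcyc (Γ : SimpleGraph V) (R : Set V) : Set Γ.EdgeOrientation :=
  {O | O.IsAcyclic ∧ ∀ v, O.IsSource v ↔ v ∈ R}

variable {Γ : SimpleGraph V} {R : Set V}

theorem exists_mem_isTransversal (Γ : SimpleGraph V) (v : V) : ∃ R, v ∈ R ∧ Γ.IsTransversal R := by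
  classical
  let c : V → Γ.ConnectedComponent := Γ.connectedComponentMk
  let g : Γ.ConnectedComponent → V := fun x => if x = c v then v else Quot.out x
  have hg : ∀ x, c (g x) = x := by
    intro x
    by_cases hx : x = c v
    · simp [g, hx]
    · simp only [g, if_neg hx]
      exact Quot.out_eq x
  refine ⟨Set.range g, ⟨c v, by simp [g]⟩, fun u => ⟨g (c u), ⟨_, rfl⟩, ?_⟩, ?_⟩
  · exact (ConnectedComponent.eq.1 (hg (c u))).symm
  · rintro _ ⟨x, rfl⟩ _ ⟨y, rfl⟩ h
    have : c (g x) = c (g y) := ConnectedComponent.eq.2 h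
    rw [hg, hg] at this
    rw [this]

theorem exists_isTransversal (Γ : SimpleGraph V) : ∃ R, Γ.IsTransversal R := by
  cases isEmpty_or_nonempty V with
  | inl _ => exact ⟨∅, fun u => isEmptyElim u, fun r => isEmptyElim r⟩
  | inr h => exact h.elim fun v => (exists_mem_isTransversal Γ v).imp fun _ h => h.2

/-- Every component contains a source of an acyclic orientation. -/
theorem EdgeOrientation.IsAcyclic.exists_isSource_reachable [Finite V] {O : Γ.EdgeOrientation}
    (hO : O.IsAcyclic) (u : V) : ∃ s, O.IsSource s ∧ Γ.Reachable s u := by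
  obtain ⟨s, hs, hs'⟩ := hO.exists_forall_not_dir (M := {x | Γ.Reachable x u}) ⟨u, .refl _⟩
  exact ⟨s, fun i hi => hs' i ((O.adj_of_dir _ _ hi).reachable.trans hs) hi, hs⟩

theorem exists_isShift_of_eqvGen {O O' : Γ.Acyc} (h : EqvGen Click O O') :
    ∃ f, IsShift O.1 O'.1 f := by
  induction h with
  | rel x y h =>
    classical
    obtain ⟨v, hv, hy⟩ := h
    exact ⟨_, hy ▸ hv.isShift⟩
  | refl x => exact ⟨_, .refl _⟩
  | symm x y _ ih => obtain ⟨f, hf⟩ := ih; exact ⟨_, hf.symm⟩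
  | trans x y z _ _ ih ih' =>
    obtain ⟨f, hf⟩ := ih
    obtain ⟨g, hg⟩ := ih'
    exact ⟨_, hf.trans hg⟩

theorem eq_of_isShift_of_mem_rootedAcyc [Finite V] (hR : Γ.IsTransversal R)
    {O O' : Γ.EdgeOrientation} (hO : O ∈ Γ.rootedAcyc R) (hO' : O' ∈ Γ.rootedAcyc R)
    {f : V → ℤ} (h : IsShift O O' f) : O = O' := by
  choose root hroot hreach using hR.spans
  have hadj : ∀ i j, Γ.Adj i j → root i = root j := fun i j hij =>
    hR.eq_of_reachable _ (hroot i) _ (hroot j)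
      ((hreach i).symm.trans (hij.reachable.trans (hreach j)))
  have hfix : ∀ r ∈ R, root r = r := fun r hr =>
    hR.eq_of_reachable _ (hroot r) _ hr (hreach r).symm
  -- Adjacent vertices have the same root, so subtracting the value at the root keeps a shift and
  -- makes it vanish on `R`.
  have hg : IsShift O O' (fun v => f v - f (root v)) := fun i j hij => by
    have := h i j hij
    simp only [hadj i j hij]
    linarith
  refine hg.eq_of_eq_zero fun v => le_antisymm ?_ ?_
  · refine hg.nonpos hO.1 (fun s hs => ?_) v
    rw [hfix s ((hO.2 s).1 hs), sub_self]
  · have := hg.symm.nonpos hO'.1 (fun s hs => by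
      simp only [Pi.neg_apply]
      rw [hfix s ((hO'.2 s).1 hs), sub_self, neg_zero]) v
    simpa using this

/-- The length of a walk bounds all such `f` at once; this uniformity makes the set of possible
click counts finite. -/
theorem Reachable.exists_bound {u r : V} (h : Γ.Reachable u r) :
    ∃ n : ℕ, ∀ f : V → ℤ, (∀ i j, Γ.Adj i j → f i ≤ f j + 1) → f u ≤ f r + n := by
  obtain ⟨p⟩ := h
  induction p with
  | nil => exact ⟨0, fun f _ => by simp⟩
  | @cons a b c hab p ih =>
    obtain ⟨n, hn⟩ := ih
    refine ⟨n + 1, fun f hf => ?_⟩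
    have := hn f hf
    have := hf a b hab
    push_cast
    linarith

/-- Clicking as long as possible vertices outside `R` ends at an orientation all of whose
sources lie in `R`. -/
theorem exists_eqvGen_sources_subset [Finite V] (hR : Γ.Spans R) (O : Γ.Acyc) :
    ∃ O' : Γ.Acyc, EqvGen Click O O' ∧ ∀ v, O'.1.IsSource v → v ∈ R := by
  classical
  have := Fintype.ofFinite V
  choose root hroot hreach using hR
  choose B hB using fun u => (hreach u).exists_bound
  let F : Set (V → ℤ) := {f | 0 ≤ f ∧ (∀ r ∈ R, f r = 0) ∧
    ∃ O' : Γ.Acyc, EqvGen Click O O' ∧ IsShift O.1 O'.1 f}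
  have hfin : F.Finite := by
    refine (Set.finite_Icc (0 : V → ℤ) (fun v => (B v : ℤ))).subset ?_
    rintro f ⟨h0, hfR, O', -, hsh⟩
    refine ⟨h0, fun u => ?_⟩
    have := hB u f fun i j hij => by
      have := hsh i j hij
      have := O.1.indicator_le_one i j
      have := O'.1.indicator_nonneg i j
      linarith
    rwa [hfR _ (hroot u), zero_add] at this
  obtain ⟨f, ⟨h0, hfR, O', hOO', hsh⟩, hmax⟩ :=
    hfin.exists_maximal ⟨0, le_rfl, fun _ _ => rfl, O, .refl _, .refl _⟩
  refine ⟨O', hOO', fun v hv => by_contra fun hvR => ?_⟩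
  have hle : f ≤ f + Pi.single v 1 := by
    refine le_add_of_nonneg_right ?_
    exact Pi.single_nonneg.2 zero_le_one
  -- A source `v` outside `R` could be clicked once more, contradicting maximality of `f`.
  have := hmax (y := f + Pi.single v 1) ⟨h0.trans hle, fun r hr => ?_,
    ⟨O'.1.reverseAt v, O'.2.reverseAt hv⟩, hOO'.trans _ _ _ (.rel _ _ ⟨v, hv, rfl⟩),
    hsh.trans hv.isShift⟩ hle v
  · simp at this
  · have : r ≠ v := fun h => hvR (h ▸ hr)
    simp [hfR r hr, this]

/-- Each `κ`-class contains exactly one orientation whose set of sources is a given transversal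
of the connected components. -/
theorem kappa_eq_ncard_rootedAcyc [Finite V] (hR : Γ.IsTransversal R) :
    Γ.kappa = (Γ.rootedAcyc R).ncard := by
  symm
  refine Nat.card_eq_of_bijective
    (fun O : Γ.rootedAcyc R => (Quotient.mk Γ.kappaSetoid ⟨O.1, O.2.1⟩)) ⟨?_, ?_⟩
  · intro O O' h
    obtain ⟨f, hf⟩ := exists_isShift_of_eqvGen (Quotient.exact h)
    exact Subtype.ext (eq_of_isShift_of_mem_rootedAcyc hR O.2 O'.2 hf)
  · intro q
    induction q using Quotient.inductionOn with
    | h O =>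
      obtain ⟨O', hO', hs⟩ := exists_eqvGen_sources_subset hR.spans O
      refine ⟨⟨O'.1, O'.2, fun v => ⟨hs v, fun hv => ?_⟩⟩, ?_⟩
      · obtain ⟨s, hs', hsv⟩ := O'.2.exists_isSource_reachable v
        exact hR.eq_of_reachable s (hs s hs') v hv hsv ▸ hs'
      · exact Quotient.sound (hO'.symm _ _)

end SimpleGraph

namespace SimpleGraph

open EdgeOrientation

variable {V W : Type*} {Γ : SimpleGraph V} {R : Set V}

/-! ### Reachability -/

/-- Follow the walk until it first uses the edge `vw`. -/
theorem Reachable.of_adj_or {G H : SimpleGraph V} {u r v w : V}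
    (hG : ∀ x y, G.Adj x y → H.Adj x y ∨ s(x, y) = s(v, w)) (h : G.Reachable u r) :
    H.Reachable u r ∨ H.Reachable u v ∨ H.Reachable u w := by
  obtain ⟨p⟩ := h
  induction p with
  | nil => exact Or.inl (.refl _)
  | @cons a b c hab p ih =>
    rcases hG a b hab with h | h
    · exact ih.imp h.reachable.trans (Or.imp h.reachable.trans h.reachable.trans)
    · rcases Sym2.eq_iff.1 h with ⟨rfl, -⟩ | ⟨rfl, -⟩
      · exact Or.inr (Or.inl (.refl _))
      · exact Or.inr (Or.inr (.refl _))

/-- As `v` is already a root, the edge `vw` helps only by giving `w` access to a root. -/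
theorem spans_iff_spans_insert {G H : SimpleGraph V} {v w : V} (hle : H ≤ G) (hvw : G.Adj v w)
    (hG : ∀ x y, G.Adj x y → H.Adj x y ∨ s(x, y) = s(v, w)) (hv : v ∈ R) :
    G.Spans R ↔ H.Spans (insert w R) := by
  refine ⟨fun h u => ?_, fun h u => ?_⟩
  · obtain ⟨r, hr, hur⟩ := h u
    rcases hur.of_adj_or hG with h1 | h1 | h1
    · exact ⟨r, Or.inr hr, h1⟩
    · exact ⟨v, Or.inr hv, h1⟩
    · exact ⟨w, Or.inl rfl, h1⟩
  · obtain ⟨r, rfl | hr, hur⟩ := h u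
    · exact ⟨v, hv, (hur.mono hle).trans hvw.symm.reachable⟩
    · exact ⟨r, hr, hur.mono hle⟩

theorem adj_deleteEdges_or (Γ : SimpleGraph V) (e : Sym2 V) (x y : V) (h : Γ.Adj x y) :
    (Γ.deleteEdges {e}).Adj x y ∨ s(x, y) = e := by
  rw [deleteEdges_adj, Set.mem_singleton_iff]
  tauto

theorem Spans.exists_adj {w : V} (h : Γ.Spans R) (hw : w ∉ R) : ∃ x ∈ R, ∃ y ∉ R, Γ.Adj x y := by
  obtain ⟨r, hr, ⟨p⟩⟩ := h w
  induction p with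
  | nil => exact absurd hr hw
  | @cons a b c hab p ih =>
    by_cases hb : b ∈ R
    · exact ⟨b, hb, a, hw, hab.symm⟩
    · exact ih hb hr

theorem spans_of_mem_rootedAcyc [Finite V] {O : Γ.EdgeOrientation} (h : O ∈ Γ.rootedAcyc R) :
    Γ.Spans R := fun u => by
  obtain ⟨s, hs, hsu⟩ := h.1.exists_isSource_reachable u
  exact ⟨s, (h.2 s).1 hs, hsu.symm⟩

theorem rootedAcyc_eq_empty [Finite V] (h : ¬ Γ.Spans R) : Γ.rootedAcyc R = ∅ :=
  Set.eq_empty_of_forall_notMem fun _ hO => h (spans_of_mem_rootedAcyc hO)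

/-! ### Deletion of an edge -/

/-- The restriction of an orientation to a spanning subgraph. -/
def EdgeOrientation.restrict {H : SimpleGraph V} (O : Γ.EdgeOrientation) (h : H ≤ Γ) :
    H.EdgeOrientation where
  Dir i j := H.Adj i j ∧ O.Dir i j
  adj_of_dir _ _ hij := hij.1
  xor_of_adj i j hij := by
    have := O.xor_of_adj i j (h hij)
    have := hij.symm
    unfold Xor at *
    tauto

/-- The edge between a root `v` and a vertex `w` which is not a root is oriented as `(v, w)`;
after its deletion, `w` may or may not be a source. -/
theorem ncard_rootedAcyc_eq_add [Finite V] {v w : V} (hvw : Γ.Adj v w) (hv : v ∈ R)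
    (hw : w ∉ R) :
    (Γ.rootedAcyc R).ncard = ((Γ.deleteEdges {s(v, w)}).rootedAcyc R).ncard +
      ((Γ.deleteEdges {s(v, w)}).rootedAcyc (insert w R)).ncard := by
  have hle : Γ.deleteEdges {s(v, w)} ≤ Γ := deleteEdges_le _
  have hne := hvw.ne
  have hdir : ∀ O ∈ Γ.rootedAcyc R, ∀ i j, O.Dir i j →
      (O.restrict hle).Dir i j ∨ (i = v ∧ j = w) := by
    intro O hO i j hij
    rcases adj_deleteEdges_or Γ s(v, w) i j (O.adj_of_dir i j hij) with h | h
    · exact Or.inl ⟨h, hij⟩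
    · rcases Sym2.eq_iff.1 h with h | ⟨rfl, rfl⟩
      · exact Or.inr h
      · exact absurd hij ((hO.2 j).2 hv i)
  have hdir' : ∀ O ∈ Γ.rootedAcyc R, O.Dir v w := fun O hO =>
    (O.dir_or_dir hvw).resolve_right ((hO.2 v).2 hv w)
  have hinj : Set.InjOn (fun O : Γ.EdgeOrientation => O.restrict hle) (Γ.rootedAcyc R) := by
    intro O hO O' hO' h
    refine ext_of_le fun i j hij => ?_
    rcases hdir O hO i j hij with h1 | ⟨rfl, rfl⟩
    · simp only at h
      rw [h] at h1
      exact h1.2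
    · exact hdir' O' hO'
  rw [← Set.ncard_union_eq, ← hinj.ncard_image]
  · congr 1
    ext O'
    constructor
    · rintro ⟨O, hO, rfl⟩
      have hac : (O.restrict hle).IsAcyclic :=
        hO.1.of_forall_dir id fun _ _ h => h.2
      have hsrc : ∀ x, x ≠ w → ((O.restrict hle).IsSource x ↔ x ∈ R) := by
        intro x hx
        rw [← hO.2 x]
        refine ⟨fun h i hi => ?_, fun h i hi => h i hi.2⟩
        rcases hdir O hO i x hi with h1 | h1
        · exact h i h1
        · exact hx h1.2
      by_cases hs : (O.restrict hle).IsSource w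
      · refine Or.inr ⟨hac, fun x => ?_⟩
        by_cases hx : x = w
        · subst hx
          simpa using hs
        · simpa [hx] using hsrc x hx
      · refine Or.inl ⟨hac, fun x => ?_⟩
        by_cases hx : x = w
        · subst hx
          exact iff_of_false hs hw
        · exact hsrc x hx
    · intro hO'
      have hac : O'.IsAcyclic := hO'.elim And.left And.left
      have hsrc : ∀ x, x ≠ w → (O'.IsSource x ↔ x ∈ R) := by
        intro x hx
        rcases hO' with h | h
        · exact h.2 x
        · simpa [hx] using h.2 x
      have hvs : O'.IsSource v := (hsrc v hne).2 hv
      have hnd : ¬ O'.Dir v w := fun h => by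
        simpa using O'.adj_of_dir _ _ h
      let O : Γ.EdgeOrientation :=
        { Dir := fun i j => O'.Dir i j ∨ (i = v ∧ j = w)
          adj_of_dir := by
            rintro i j (h | ⟨rfl, rfl⟩)
            · exact hle (O'.adj_of_dir i j h)
            · exact hvw
          xor_of_adj := by
            intro i j hij
            rcases adj_deleteEdges_or Γ s(v, w) i j hij with h | h
            · have h1 := O'.xor_of_adj i j h
              have h2 : ¬ (i = v ∧ j = w) := by
                rintro ⟨rfl, rfl⟩; simp at h
              have h3 : ¬ (j = v ∧ i = w) := by
                rintro ⟨rfl, rfl⟩; simp [Sym2.eq_swap] at h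
              simpa [h2, h3] using h1
            · have := hvs w
              unfold Xor
              rcases Sym2.eq_iff.1 h with ⟨rfl, rfl⟩ | ⟨rfl, rfl⟩ <;> tauto }
      have hOs : ∀ x, O.IsSource x ↔ x ∈ R := by
        intro x
        by_cases hx : x = w
        · subst hx
          exact iff_of_false (fun h => h v (Or.inr ⟨rfl, rfl⟩)) hw
        · rw [← hsrc x hx]
          exact ⟨fun h i hi => h i (Or.inl hi),
            fun h i hi => hi.elim (h i) fun h' => hx h'.2⟩
      refine ⟨O, ⟨?_, hOs⟩, (ext_of_le
        (O' := O.restrict hle) fun i j hij => ⟨O'.adj_of_dir i j hij, Or.inl hij⟩).symm⟩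
      classical
      obtain ⟨h, hh⟩ := hac.exists_height
      -- Putting the source `v` below everything makes the added edge `v → w` ascend.
      refine isAcyclic_of_height (fun x => if x = v then 0 else h x + 1) ?_
      intro i j hij
      have hj : j ≠ v := by
        rintro rfl
        exact (hOs j).2 hv i hij
      simp only [hj, if_false]
      split_ifs with hi
      · exact Nat.succ_pos _
      · rcases hij with hij | hij
        · exact Nat.succ_lt_succ (hh i j hij)
        · exact absurd hij.1 hi
  · rw [Set.disjoint_left]
    intro O h1 h2
    exact hw ((h1.2 w).1 ((h2.2 w).2 (Or.inl rfl)))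

/-- Without the bridge, `w` reaches no root: `R` no longer spans, and `insert w R` is a transversal.
-/
theorem kappa_deleteEdges_of_isBridge [Finite V] {v w : V} (hvw : Γ.Adj v w)
    (hb : Γ.IsBridge s(v, w)) : Γ.kappa = (Γ.deleteEdges {s(v, w)}).kappa := by
  obtain ⟨R, hv, hR⟩ := exists_mem_isTransversal Γ v
  have hle : Γ.deleteEdges {s(v, w)} ≤ Γ := deleteEdges_le _
  rw [isBridge_iff] at hb
  have hw : w ∉ R := fun hw => hvw.ne (hR.eq_of_reachable v hv w hw hvw.reachable)
  have hv' : ∀ r ∈ R, ¬ (Γ.deleteEdges {s(v, w)}).Reachable w r := fun r hr h => by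
    have := hR.eq_of_reachable v hv r hr (hvw.reachable.trans (h.mono hle))
    exact hb (this ▸ h.symm)
  have hns : ¬ (Γ.deleteEdges {s(v, w)}).Spans R := fun h => by
    obtain ⟨r, hr, hwr⟩ := h w
    exact hv' r hr hwr
  have hR' : (Γ.deleteEdges {s(v, w)}).IsTransversal (insert w R) := by
    refine ⟨(spans_iff_spans_insert hle hvw (adj_deleteEdges_or Γ _) hv).1 hR.spans, ?_⟩
    rintro r (rfl | hr) r' (rfl | hr') h
    · rfl
    · exact absurd h (hv' r' hr')
    · exact absurd h.symm (hv' r hr)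
    · exact hR.eq_of_reachable r hr r' hr' (h.mono hle)
  rw [kappa_eq_ncard_rootedAcyc hR, kappa_eq_ncard_rootedAcyc hR',
    ncard_rootedAcyc_eq_add hvw hv hw, rootedAcyc_eq_empty hns, Set.ncard_empty, zero_add]

/-! ### Disjoint unions -/

/-- The orientation induced on a set of vertices. -/
def EdgeOrientation.induce (O : Γ.EdgeOrientation) (S : Set V) :
    (Γ.induce S).EdgeOrientation where
  Dir i j := O.Dir i j
  adj_of_dir i j hij := O.adj_of_dir i j hij
  xor_of_adj i j hij := O.xor_of_adj i j hij

theorem EdgeOrientation.IsAcyclic.induce {O : Γ.EdgeOrientation} (hO : O.IsAcyclic) (S : Set V) :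
    (O.induce S).IsAcyclic :=
  hO.of_forall_dir Subtype.val fun _ _ h => h

variable {S : Set V}

theorem EdgeOrientation.isSource_induce_iff (hS : ∀ x y, Γ.Adj x y → (x ∈ S ↔ y ∈ S))
    (O : Γ.EdgeOrientation) (x : S) : (O.induce S).IsSource x ↔ O.IsSource x :=
  ⟨fun h i hi => h ⟨i, (hS i x (O.adj_of_dir _ _ hi)).2 x.2⟩ hi, fun h i hi => h i hi⟩

theorem mem_compl_iff_of_adj (hS : ∀ x y, Γ.Adj x y → (x ∈ S ↔ y ∈ S)) (x y : V)
    (h : Γ.Adj x y) : x ∈ Sᶜ ↔ y ∈ Sᶜ := not_congr (hS x y h)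

theorem mem_rootedAcyc_iff_induce [Finite V] (hS : ∀ x y, Γ.Adj x y → (x ∈ S ↔ y ∈ S))
    (O : Γ.EdgeOrientation) :
    O ∈ Γ.rootedAcyc R ↔ O.induce S ∈ (Γ.induce S).rootedAcyc (Subtype.val ⁻¹' R) ∧
      O.induce Sᶜ ∈ (Γ.induce Sᶜ).rootedAcyc (Subtype.val ⁻¹' R) := by
  have hS' := mem_compl_iff_of_adj hS
  constructor
  · intro hO
    exact ⟨⟨hO.1.induce S, fun x => (O.isSource_induce_iff hS x).trans (hO.2 x)⟩,
      ⟨hO.1.induce Sᶜ, fun x => (O.isSource_induce_iff hS' x).trans (hO.2 x)⟩⟩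
  · rintro ⟨h1, h2⟩
    constructor
    · classical
      obtain ⟨f, hf⟩ := h1.1.exists_height
      obtain ⟨g, hg⟩ := h2.1.exists_height
      refine isAcyclic_of_height (fun x => if hx : x ∈ S then f ⟨x, hx⟩ else g ⟨x, hx⟩) ?_
      intro i j hij
      have := hS i j (O.adj_of_dir i j hij)
      by_cases hi : i ∈ S
      · simp only [dif_pos hi, dif_pos (this.1 hi)]
        exact hf ⟨i, hi⟩ ⟨j, this.1 hi⟩ hij
      · have hj : j ∉ S := fun h => hi (this.2 h)
        simp only [dif_neg hi, dif_neg hj]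
        exact hg ⟨i, hi⟩ ⟨j, hj⟩ hij
    · intro x
      by_cases hx : x ∈ S
      · exact (O.isSource_induce_iff hS ⟨x, hx⟩).symm.trans (h1.2 ⟨x, hx⟩)
      · exact (O.isSource_induce_iff hS' ⟨x, hx⟩).symm.trans (h2.2 ⟨x, hx⟩)

theorem bijective_induce_prod (hS : ∀ x y, Γ.Adj x y → (x ∈ S ↔ y ∈ S)) :
    Function.Bijective (fun O : Γ.EdgeOrientation => (O.induce S, O.induce Sᶜ)) := by
  constructor
  · intro O O' h
    obtain ⟨h1, h2⟩ := Prod.ext_iff.1 h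
    refine ext_of_le fun i j hij => ?_
    have := hS i j (O.adj_of_dir i j hij)
    by_cases hi : i ∈ S
    · have h3 : (O.induce S).Dir ⟨i, hi⟩ ⟨j, this.1 hi⟩ := hij
      simp only at h1
      rwa [h1] at h3
    · have h3 : (O.induce Sᶜ).Dir ⟨i, hi⟩ ⟨j, fun h => hi (this.2 h)⟩ := hij
      simp only at h2
      rwa [h2] at h3
  · rintro ⟨O₁, O₂⟩
    let O : Γ.EdgeOrientation :=
      { Dir := fun i j => (∃ (hi : i ∈ S) (hj : j ∈ S), O₁.Dir ⟨i, hi⟩ ⟨j, hj⟩) ∨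
          (∃ (hi : i ∈ Sᶜ) (hj : j ∈ Sᶜ), O₂.Dir ⟨i, hi⟩ ⟨j, hj⟩)
        adj_of_dir := by
          rintro i j (⟨hi, hj, h⟩ | ⟨hi, hj, h⟩)
          · exact O₁.adj_of_dir _ _ h
          · exact O₂.adj_of_dir _ _ h
        xor_of_adj := by
          intro i j hij
          by_cases hi : i ∈ S
          · have hj := (hS i j hij).1 hi
            simpa [hi, hj] using O₁.xor_of_adj ⟨i, hi⟩ ⟨j, hj⟩ hij
          · have hj : j ∉ S := fun h => hi ((hS i j hij).2 h)
            simpa [hi, hj] using O₂.xor_of_adj ⟨i, hi⟩ ⟨j, hj⟩ hij }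
    refine ⟨O, Prod.ext ?_ ?_⟩
    · exact (ext_of_le fun i j hij => Or.inl ⟨i.2, j.2, hij⟩).symm
    · exact (ext_of_le fun i j hij => Or.inr ⟨i.2, j.2, hij⟩).symm

theorem Reachable.induce_of_mem (hS : ∀ x y, Γ.Adj x y → (x ∈ S ↔ y ∈ S)) {x y : V}
    (h : Γ.Reachable x y) (hx : x ∈ S) : ∃ hy : y ∈ S, (Γ.induce S).Reachable ⟨x, hx⟩ ⟨y, hy⟩ := by
  obtain ⟨p⟩ := h
  induction p with
  | nil => exact ⟨hx, .refl _⟩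
  | @cons a b c hab p ih =>
    obtain ⟨hy, hr⟩ := ih ((hS a b hab).1 hx)
    have : (Γ.induce S).Adj ⟨a, hx⟩ ⟨b, (hS a b hab).1 hx⟩ := hab
    exact ⟨hy, this.reachable.trans hr⟩

theorem IsTransversal.induce (hS : ∀ x y, Γ.Adj x y → (x ∈ S ↔ y ∈ S))
    (hR : Γ.IsTransversal R) : (Γ.induce S).IsTransversal (Subtype.val ⁻¹' R) := by
  refine ⟨fun u => ?_, fun r hr r' hr' h => ?_⟩
  · obtain ⟨r, hr, hur⟩ := hR.spans u
    obtain ⟨hrS, h⟩ := hur.induce_of_mem hS u.2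
    exact ⟨⟨r, hrS⟩, hr, h⟩
  · exact Subtype.ext (hR.eq_of_reachable r hr r' hr' (h.map (Embedding.induce S).toHom))

theorem kappa_eq_mul_of_forall_adj [Finite V]
    (hS : ∀ x y, Γ.Adj x y → (x ∈ S ↔ y ∈ S)) :
    Γ.kappa = (Γ.induce S).kappa * (Γ.induce Sᶜ).kappa := by
  obtain ⟨R, hR⟩ := exists_isTransversal Γ
  rw [kappa_eq_ncard_rootedAcyc hR, kappa_eq_ncard_rootedAcyc (hR.induce hS),
    kappa_eq_ncard_rootedAcyc (hR.induce (mem_compl_iff_of_adj hS)), ← Set.ncard_prod,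
    ← Set.ncard_image_of_injective _ (bijective_induce_prod hS).1]
  congr 1
  ext p
  obtain ⟨O, rfl⟩ := (bijective_induce_prod hS).2 p
  rw [(bijective_induce_prod hS).1.mem_set_image, mem_rootedAcyc_iff_induce hS]
  rfl

/-! ### Contraction of an edge -/

/-- The orientation of `Γ` which an orientation of the image of `Γ` induces. -/
def EdgeOrientation.pullback {π : V → W} (hπ : ∀ x y, Γ.Adj x y → π x ≠ π y)
    (O : (Γ.map π).EdgeOrientation) : Γ.EdgeOrientation where
  Dir i j := Γ.Adj i j ∧ O.Dir (π i) (π j)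
  adj_of_dir _ _ hij := hij.1
  xor_of_adj i j hij := by
    have := O.xor_of_adj (π i) (π j) ⟨hπ i j hij, i, j, hij, rfl, rfl⟩
    have := hij.symm
    unfold Xor at *
    tauto

/-- Roots may be identified, provided that no two of them are adjacent. -/
theorem ncard_rootedAcyc_map [Finite V] {π : V → W} (hsurj : Function.Surjective π)
    (hπ : ∀ x y, π x = π y → x = y ∨ (x ∈ R ∧ y ∈ R)) (hR : ∀ x ∈ R, ∀ y ∈ R, ¬ Γ.Adj x y) :
    ((Γ.map π).rootedAcyc (π '' R)).ncard = (Γ.rootedAcyc R).ncard := by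
  have hne : ∀ x y, Γ.Adj x y → π x ≠ π y := by
    intro x y hxy h
    rcases hπ x y h with h | ⟨h, h'⟩
    · exact hxy.ne h
    · exact hR x h y h' hxy
  have hmem : ∀ x, π x ∈ π '' R ↔ x ∈ R := by
    refine fun x => ⟨?_, fun h => ⟨x, h, rfl⟩⟩
    rintro ⟨r, hr, h⟩
    rcases hπ r x h with rfl | h
    · exact hr
    · exact h.2
  have hinj : Function.Injective
      (fun O : (Γ.map π).EdgeOrientation => O.pullback hne) := by
    intro O O' h
    refine ext_of_le fun a b hab => ?_
    obtain ⟨-, i, j, hij, rfl, rfl⟩ := O.adj_of_dir a b hab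
    have h1 : (O.pullback hne).Dir i j := ⟨hij, hab⟩
    simp only at h
    rw [h] at h1
    exact h1.2
  rw [← Set.ncard_image_of_injective _ hinj]
  congr 1
  ext O'
  constructor
  · rintro ⟨O, hO, rfl⟩
    refine ⟨hO.1.of_forall_dir π fun _ _ h => h.2, fun x => ?_⟩
    rw [← hmem, ← hO.2]
    refine ⟨fun h => by_contra fun hn => ?_, fun h i hi => h _ hi.2⟩
    have hn' := hn
    rw [hO.2, hmem] at hn'
    obtain ⟨a, ha⟩ : ∃ a, O.Dir a (π x) := by
      unfold IsSource at hn
      push Not at hn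
      exact hn
    obtain ⟨-, i, j, hij, rfl, hjx⟩ := O.adj_of_dir _ _ ha
    rcases hπ j x hjx with rfl | h'
    · exact h i ⟨hij, ha⟩
    · exact hn' h'.2
  · intro hO'
    have hnr : ∀ i j, O'.Dir i j → j ∉ R := fun i j hij hj => (hO'.2 j).2 hj i hij
    let O : (Γ.map π).EdgeOrientation :=
      { Dir := fun a b => ∃ i j, O'.Dir i j ∧ π i = a ∧ π j = b
        adj_of_dir := by
          rintro _ _ ⟨i, j, h, rfl, rfl⟩
          have := O'.adj_of_dir i j h
          exact ⟨hne i j this, i, j, this, rfl, rfl⟩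
        xor_of_adj := by
          rintro _ _ ⟨-, i, j, hij, rfl, rfl⟩
          have hor : (∃ i' j', O'.Dir i' j' ∧ π i' = π i ∧ π j' = π j) ∨
              (∃ i' j', O'.Dir i' j' ∧ π i' = π j ∧ π j' = π i) :=
            (O'.dir_or_dir hij).imp (fun h => ⟨i, j, h, rfl, rfl⟩) fun h => ⟨j, i, h, rfl, rfl⟩
          have hand : ¬ ((∃ i' j', O'.Dir i' j' ∧ π i' = π i ∧ π j' = π j) ∧
              (∃ i' j', O'.Dir i' j' ∧ π i' = π j ∧ π j' = π i)) := by
            -- The head of an edge of `O'` is never a root, so its fibre under `π` is a single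
            -- point; opposite images thus come from opposite edges.
            rintro ⟨⟨a, b, hab, ha, hb⟩, c, d, hcd, hc, hd⟩
            rcases hπ a d (ha.trans hd.symm) with rfl | h
            · rcases hπ b c (hb.trans hc.symm) with rfl | h
              · exact O'.dir_asymm hab hcd
              · exact hnr _ _ hab h.1
            · exact hnr _ _ hcd h.2
          exact (xor_iff_or_and_not_and _ _).2 ⟨hor, hand⟩ }
    have hOO' : O.pullback hne = O' :=
      (ext_of_le (O' := O.pullback hne)
        fun i j hij => ⟨O'.adj_of_dir i j hij, i, j, hij, rfl, rfl⟩).symm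
    refine ⟨O, ⟨?_, fun a => ?_⟩, hOO'⟩
    · classical
      obtain ⟨h, hh⟩ := hO'.1.exists_height
      have hinv : ∀ x, x ∉ R → Function.surjInv hsurj (π x) = x := fun x hx =>
        (hπ _ _ (Function.surjInv_eq hsurj (π x))).resolve_right fun h => hx h.2
      -- All roots share height `0`; any other vertex is the only preimage of its image, so its old
      -- height is well defined.
      refine isAcyclic_of_height
        (fun a => if a ∈ π '' R then 0 else h (Function.surjInv hsurj a) + 1) ?_
      rintro _ _ ⟨i, j, hij, rfl, rfl⟩
      have hj := hnr i j hij
      simp only [hmem, if_neg hj]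
      split_ifs with hi
      · exact Nat.succ_pos _
      · rw [hinv i hi, hinv j hj]
        exact Nat.succ_lt_succ (hh i j hij)
    · obtain ⟨x, rfl⟩ := hsurj a
      rw [hmem]
      refine ⟨fun h => (hO'.2 x).1 fun i hi => h (π i) ⟨i, x, hi, rfl, rfl⟩, ?_⟩
      rintro hx _ ⟨i, j, hij, -, hj⟩
      rcases hπ j x hj with rfl | h
      · exact hnr _ _ hij hx
      · exact hnr _ _ hij h.1

/-- The predicate `x = z ∨ s(x, z) = e` in `z` respects the identification, so it descends to the
quotient. -/
theorem contractVert_mk_eq {e : Sym2 V} {x y : V}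
    (h : (Quot.mk _ x : ContractVert e) = Quot.mk _ y) : x = y ∨ s(x, y) = e := by
  have key : ∀ a b, s(a, b) = e → (x = a ∨ s(x, a) = e) = (x = b ∨ s(x, b) = e) := by
    rintro a b rfl
    simp only [Sym2.eq_iff, eq_iff_iff]
    tauto
  have h' : (x = x ∨ s(x, x) = e) = (x = y ∨ s(x, y) = e) :=
    congrArg (Quot.lift (fun z => x = z ∨ s(x, z) = e) key) h
  exact h'.mp (Or.inl rfl)

theorem Reachable.of_map {π : V → W} (hπ : ∀ x y, π x = π y → Γ.Reachable x y) {a b : W}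
    (h : (Γ.map π).Reachable a b) : ∀ x y, π x = a → π y = b → Γ.Reachable x y := by
  obtain ⟨p⟩ := h
  induction p with
  | nil => exact fun x y hx hy => hπ x y (hx.trans hy.symm)
  | @cons a b c hab p ih =>
    intro x y hx hy
    obtain ⟨-, i, j, hij, rfl, rfl⟩ := hab
    exact (hπ x i hx).trans (hij.reachable.trans (ih j y rfl hy))

theorem Reachable.map_image {π : V → W} {x y : V} (h : Γ.Reachable x y) :
    (Γ.map π).Reachable (π x) (π y) := by
  obtain ⟨p⟩ := h
  induction p with
  | nil => exact .refl _
  | @cons a b c hab p ih =>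
    by_cases hne : π a = π b
    · rwa [hne]
    · have : (Γ.map π).Adj (π a) (π b) := ⟨hne, a, b, hab, rfl, rfl⟩
      exact this.reachable.trans ih

theorem kappa_eq_add_of_isCycleEdge [Finite V] {e : Sym2 V} (he : Γ.IsCycleEdge e) :
    Γ.kappa = (Γ.deleteEdges {e}).kappa + (Γ.contractEdge e).kappa := by
  induction e using Sym2.ind with
  | _ v w =>
  obtain ⟨hvw, hnb⟩ := he
  rw [mem_edgeSet] at hvw
  rw [isBridge_iff, not_not] at hnb
  obtain ⟨R, hv, hR⟩ := exists_mem_isTransversal Γ v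
  have hle : Γ.deleteEdges {s(v, w)} ≤ Γ := deleteEdges_le _
  have hw : w ∉ R := fun hw => hvw.ne (hR.eq_of_reachable v hv w hw hvw.reachable)
  have hreach : ∀ x y, Γ.Reachable x y → (Γ.deleteEdges {s(v, w)}).Reachable x y := by
    rintro x y ⟨p⟩
    induction p with
    | nil => exact .refl _
    | @cons a b c hab p ih =>
      rcases adj_deleteEdges_or Γ s(v, w) a b hab with h | h
      · exact h.reachable.trans ih
      · rcases Sym2.eq_iff.1 h with ⟨rfl, rfl⟩ | ⟨rfl, rfl⟩
        · exact hnb.trans ih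
        · exact hnb.symm.trans ih
  have hR' : (Γ.deleteEdges {s(v, w)}).IsTransversal R := by
    refine ⟨fun u => ?_, fun r hr r' hr' h => hR.eq_of_reachable r hr r' hr' (h.mono hle)⟩
    obtain ⟨r, hr, h⟩ := hR.spans u
    exact ⟨r, hr, hreach _ _ h⟩
  let π : V → ContractVert s(v, w) := Quot.mk _
  have hπvw : π v = π w := Quot.sound rfl
  have hπ : ∀ x y, π x = π y → x = y ∨ s(x, y) = s(v, w) := fun x y => contractVert_mk_eq
  have hsurj : Function.Surjective π := Quot.mk_surjective
  -- The contracted edge would become a loop, so deleting it beforehand changes nothing.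
  have hmap : (Γ.deleteEdges {s(v, w)}).map π = Γ.contractEdge s(v, w) := by
    refine le_antisymm (map_monotone π hle) ?_
    rintro _ _ ⟨hne, i, j, hij, rfl, rfl⟩
    rcases adj_deleteEdges_or Γ s(v, w) i j hij with h | h
    · exact ⟨hne, i, j, h, rfl, rfl⟩
    · exact absurd (show π i = π j from Quot.sound h) hne
  have himage : π '' insert w R = π '' R := by
    rw [Set.image_insert_eq, ← hπvw, Set.insert_eq_of_mem (Set.mem_image_of_mem π hv)]
  have hR'' : (Γ.contractEdge s(v, w)).IsTransversal (π '' R) := by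
    constructor
    · intro a
      obtain ⟨x, rfl⟩ := hsurj a
      obtain ⟨r, hr, h⟩ := hR.spans x
      exact ⟨π r, ⟨r, hr, rfl⟩, h.map_image⟩
    · rintro _ ⟨r, hr, rfl⟩ _ ⟨r', hr', rfl⟩ h
      refine congrArg π (hR.eq_of_reachable r hr r' hr' (h.of_map ?_ r r' rfl rfl))
      intro x y hxy
      rcases hπ x y hxy with rfl | h
      · exact .refl _
      · rcases Sym2.eq_iff.1 h with ⟨rfl, rfl⟩ | ⟨rfl, rfl⟩
        · exact hvw.reachable
        · exact hvw.symm.reachable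
  have : Finite (ContractVert s(v, w)) := Finite.of_surjective π hsurj
  rw [kappa_eq_ncard_rootedAcyc hR, kappa_eq_ncard_rootedAcyc hR',
    kappa_eq_ncard_rootedAcyc hR'', ncard_rootedAcyc_eq_add hvw hv hw, ← himage, ← hmap,
    ncard_rootedAcyc_map hsurj]
  · intro x y hxy
    refine (hπ x y hxy).imp id fun h => ?_
    rcases Sym2.eq_iff.1 h with ⟨rfl, rfl⟩ | ⟨rfl, rfl⟩ <;> simp [hv]
  · have hvR : ∀ r ∈ R, ¬ (Γ.deleteEdges {s(v, w)}).Adj w r := fun r hr h => by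
      have := hR.eq_of_reachable v hv r hr (hvw.reachable.trans (h.reachable.mono hle))
      subst this
      simp [Sym2.eq_swap] at h
    rintro x (rfl | hx) y (rfl | hy) h
    · exact h.ne rfl
    · exact hvR y hy h
    · exact hvR x hx h.symm
    · exact h.ne (hR'.eq_of_reachable x hx y hy h.reachable)

end SimpleGraph

namespace SimpleGraph

open EdgeOrientation

variable {V : Type*} {Γ : SimpleGraph V} {R : Set V}

/-! ### The Tutte polynomial -/

open Classical in
/-- The signed number of the sets of edges in `F` which connect every vertex to `R`. -/
noncomputable def spanningSum (F : Finset (Sym2 V)) (R : Set V) : ℤ :=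
  ∑ A ∈ F.powerset, if (fromEdgeSet (A : Set (Sym2 V))).Spans R then (-1) ^ A.card else 0

theorem Spans.mono {G H : SimpleGraph V} (hle : G ≤ H) (h : G.Spans R) : H.Spans R := fun u => by
  obtain ⟨r, hr, hur⟩ := h u
  exact ⟨r, hr, hur.mono hle⟩

theorem spans_fromEdgeSet_insert {A : Set (Sym2 V)} {v w : V} (hne : v ≠ w) (hv : v ∈ R) :
    (fromEdgeSet (insert s(v, w) A)).Spans R ↔ (fromEdgeSet A).Spans (insert w R) := by
  refine spans_iff_spans_insert (fromEdgeSet_mono (Set.subset_insert _ _)) ?_ ?_ hv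
  · exact (fromEdgeSet_adj _).2 ⟨Set.mem_insert _ _, hne⟩
  · intro x y hxy
    obtain ⟨h | h, hxy⟩ := (fromEdgeSet_adj _).1 hxy
    · exact Or.inr h
    · exact Or.inl ((fromEdgeSet_adj _).2 ⟨h, hxy⟩)

open Classical in
-- Split by whether `A` contains the new edge; if it does, the sign flips and the edge amounts to
-- making `w` a root.
theorem spanningSum_insert {F : Finset (Sym2 V)} {v w : V} (hF : s(v, w) ∉ F) (hne : v ≠ w)
    (hv : v ∈ R) :
    spanningSum (insert s(v, w) F) R = spanningSum F R - spanningSum F (insert w R) := by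
  unfold spanningSum
  rw [Finset.sum_powerset_insert hF, sub_eq_add_neg, ← Finset.sum_neg_distrib]
  congr 1
  refine Finset.sum_congr rfl fun A hA => ?_
  have hA' : s(v, w) ∉ A := fun h => hF (Finset.mem_powerset.1 hA h)
  rw [Finset.coe_insert, Finset.card_insert_of_notMem hA']
  simp only [spans_fromEdgeSet_insert hne hv]
  split_ifs
  · ring
  · simp

theorem spanningSum_eq_zero {F : Finset (Sym2 V)} (hF : Γ.edgeSet = F) (h : ¬ Γ.Spans R) :
    spanningSum F R = 0 := by
  refine Finset.sum_eq_zero fun A hA => if_neg fun hs => h (hs.mono ?_)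
  rw [← fromEdgeSet_edgeSet Γ, hF]
  exact fromEdgeSet_mono (by exact_mod_cast Finset.mem_powerset.1 hA)

theorem ncard_compl_insert_add_one [Finite V] {w : V} (hw : w ∉ R) :
    (insert w R)ᶜ.ncard + 1 = Rᶜ.ncard := by
  have : (insert w R)ᶜ = Rᶜ \ {w} := by
    ext x; simp [and_comm]
  rw [this, Set.ncard_sdiff_singleton_add_one hw]

theorem ncard_rootedAcyc_univ_of_edgeSet_eq_empty (h : Γ.edgeSet = ∅) :
    (Γ.rootedAcyc Set.univ).ncard = 1 := by
  have hadj : ∀ i j, ¬ Γ.Adj i j := fun i j hij => by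
    rw [← mem_edgeSet, h] at hij
    exact hij
  let O : Γ.EdgeOrientation := ⟨fun _ _ => False, fun _ _ => False.elim,
    fun i j hij => absurd hij (hadj i j)⟩
  refine Set.ncard_eq_one.2 ⟨O, Set.eq_singleton_iff_unique_mem.2 ⟨⟨?_, fun v => ?_⟩, ?_⟩⟩
  · exact isAcyclic_of_height (fun _ => 0) fun _ _ h => h.elim
  · exact iff_of_true (fun _ => id) trivial
  · exact fun O' _ => ext_of_le fun i j hij => hadj i j (O'.adj_of_dir i j hij)

/-- Both sides satisfy the deletion recursion: adding `w` to `R` lowers `|Rᶜ|` by one, which absorbs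
the minus sign of `spanningSum_insert`. -/
theorem ncard_rootedAcyc_eq_spanningSum [Finite V] (F : Finset (Sym2 V)) :
    ∀ (Γ : SimpleGraph V) (R : Set V), Γ.edgeSet = F →
      ((Γ.rootedAcyc R).ncard : ℤ) = (-1) ^ Rᶜ.ncard * spanningSum F R := by
  classical
  induction F using Finset.strongInduction with
  | H F ih =>
  intro Γ R hF
  have hmem : ∀ x y, Γ.Adj x y → s(x, y) ∈ F := fun x y hxy => by
    rw [← Finset.mem_coe, ← hF]
    exact hxy
  by_cases hRR : ∃ v ∈ R, ∃ w ∈ R, Γ.Adj v w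
  · obtain ⟨v, hv, w, hw, hvw⟩ := hRR
    have h0 : Γ.rootedAcyc R = ∅ := Set.eq_empty_of_forall_notMem fun O hO =>
      (O.dir_or_dir hvw).elim ((hO.2 w).2 hw v) ((hO.2 v).2 hv w)
    -- With both ends in `R`, the two terms of the recursion for the sum coincide and cancel.
    rw [h0, ← Finset.insert_erase (hmem v w hvw),
      spanningSum_insert (Finset.notMem_erase _ _) hvw.ne hv, Set.insert_eq_of_mem hw]
    simp
  by_cases hsp : Γ.Spans R
  swap
  · rw [rootedAcyc_eq_empty hsp, spanningSum_eq_zero hF hsp]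
    simp
  by_cases huniv : R = Set.univ
  · subst huniv
    have hE : Γ.edgeSet = ∅ := Set.eq_empty_of_forall_notMem fun e => by
      induction e using Sym2.ind with
      | _ v w => exact fun h => hRR ⟨v, trivial, w, trivial, h⟩
    have hF' : F = ∅ := by
      rw [← Finset.coe_eq_empty, ← hF, hE]
    rw [ncard_rootedAcyc_univ_of_edgeSet_eq_empty hE, hF']
    have : (⊥ : SimpleGraph V).Spans Set.univ := fun u => ⟨u, trivial, .refl _⟩
    simp [spanningSum, this]
  · obtain ⟨z, hz⟩ := (Set.ne_univ_iff_exists_notMem _).1 huniv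
    obtain ⟨v, hv, w, hw, hvw⟩ := hsp.exists_adj hz
    have hF' : (Γ.deleteEdges {s(v, w)}).edgeSet = (F.erase s(v, w) : Finset (Sym2 V)) := by
      rw [edgeSet_deleteEdges, hF, Finset.coe_erase]
    have hlt := Finset.erase_ssubset (hmem v w hvw)
    rw [ncard_rootedAcyc_eq_add hvw hv hw, Nat.cast_add, ih _ hlt _ _ hF', ih _ hlt _ _ hF',
      ← ncard_compl_insert_add_one hw]
    conv_rhs => rw [← Finset.insert_erase (hmem v w hvw),
      spanningSum_insert (Finset.notMem_erase _ _) hvw.ne hv]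
    ring

/-! ### Ranks of edge sets and evaluation at `(1, 0)`. -/

/-- Each vertex outside `R` costs an edge. This makes the natural subtraction `|A| - r(A)` exact. -/
theorem Spans.ncard_compl_le_card [Finite V] (A : Finset (Sym2 V)) :
    ∀ R : Set V, (fromEdgeSet (A : Set (Sym2 V))).Spans R → Rᶜ.ncard ≤ A.card := by
  classical
  induction A using Finset.strongInduction with
  | H A ih =>
  intro R h
  by_cases huniv : R = Set.univ
  · simp [huniv]
  · obtain ⟨z, hz⟩ := (Set.ne_univ_iff_exists_notMem _).1 huniv
    obtain ⟨v, hv, w, hw, hvw⟩ := h.exists_adj hz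
    obtain ⟨he, hne⟩ := (fromEdgeSet_adj _).1 hvw
    rw [Finset.mem_coe] at he
    rw [← Finset.insert_erase he, Finset.coe_insert, spans_fromEdgeSet_insert hne hv] at h
    have := ih _ (Finset.erase_ssubset he) _ h
    rw [← ncard_compl_insert_add_one hw, ← Finset.card_erase_add_one he]
    exact Nat.succ_le_succ this

theorem IsTransversal.card_connectedComponent (hR : Γ.IsTransversal R) :
    Nat.card Γ.ConnectedComponent = R.ncard := by
  symm
  refine Nat.card_eq_of_bijective (fun r : R => Γ.connectedComponentMk r) ⟨?_, ?_⟩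
  · intro r r' h
    exact Subtype.ext (hR.eq_of_reachable r r.2 r' r'.2 (ConnectedComponent.eq.1 h))
  · intro c
    induction c using ConnectedComponent.ind with
    | _ u =>
      obtain ⟨r, hr, h⟩ := hR.spans u
      exact ⟨⟨r, hr⟩, ConnectedComponent.eq.2 h.symm⟩

theorem IsTransversal.of_le {H : SimpleGraph V} (hR : Γ.IsTransversal R) (hle : H ≤ Γ)
    (h : H.Spans R) : H.IsTransversal R :=
  ⟨h, fun r hr r' hr' hrr' => hR.eq_of_reachable r hr r' hr' (hrr'.mono hle)⟩

/-- Components of `H` map onto those of `Γ`; if there are no more of them, this map is injective, so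
reachability in `Γ` and `H` agrees. -/
theorem IsTransversal.spans_iff [Finite V] {H : SimpleGraph V} (hR : Γ.IsTransversal R)
    (hle : H ≤ Γ) :
    H.Spans R ↔ Nat.card H.ConnectedComponent ≤ Nat.card Γ.ConnectedComponent := by
  refine ⟨fun h => ?_, fun h u => ?_⟩
  · rw [hR.card_connectedComponent, (hR.of_le hle h).card_connectedComponent]
  · have hbij := Function.Surjective.bijective_of_nat_card_le
      (ConnectedComponent.surjective_map_ofLE hle) h
    obtain ⟨r, hr, hur⟩ := hR.spans u
    exact ⟨r, hr, ConnectedComponent.eq.1 (hbij.1 (ConnectedComponent.eq.2 hur))⟩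

theorem IsTransversal.edgeRank_eq [Finite V] {A : Set (Sym2 V)}
    (hR : (fromEdgeSet A).IsTransversal R) : edgeRank A = Rᶜ.ncard := by
  rw [edgeRank, hR.card_connectedComponent, Set.ncard_compl]

theorem kappa_eq_eval_tuttePolynomial [Finite V] (Γ : SimpleGraph V) :
    (Γ.kappa : ℤ) = MvPolynomial.eval ![1, 0] Γ.tuttePolynomial := by
  classical
  obtain ⟨R, hR⟩ := exists_isTransversal Γ
  have hE := (Set.toFinite Γ.edgeSet).coe_toFinset
  have hR₀ : (fromEdgeSet Γ.edgeSet).IsTransversal R := by rwa [fromEdgeSet_edgeSet]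
  rw [kappa_eq_ncard_rootedAcyc hR, ncard_rootedAcyc_eq_spanningSum _ Γ R hE.symm, spanningSum,
    Finset.mul_sum, tuttePolynomial, map_sum]
  refine Finset.sum_congr rfl fun A hA => ?_
  have hAE : (A : Set (Sym2 V)) ⊆ Γ.edgeSet := by
    rw [← hE]
    exact_mod_cast Finset.mem_powerset.1 hA
  have hle : fromEdgeSet (A : Set (Sym2 V)) ≤ fromEdgeSet Γ.edgeSet := fromEdgeSet_mono hAE
  simp only [map_mul, map_pow, map_sub, MvPolynomial.eval_X, map_one, Matrix.cons_val_zero,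
    Matrix.cons_val_one, sub_self, zero_sub]
  split_ifs with hs
  · rw [hR₀.edgeRank_eq, (hR₀.of_le hle hs).edgeRank_eq, Nat.sub_self, pow_zero, one_mul]
    obtain ⟨k, hk⟩ := Nat.exists_eq_add_of_le (hs.ncard_compl_le_card A)
    rw [hk, Nat.add_sub_cancel_left, pow_add, ← mul_assoc, ← pow_add, ← two_mul, pow_mul]
    simp
  · rw [mul_zero, zero_pow, zero_mul]
    rw [hR₀.spans_iff hle, not_le] at hs
    -- This excludes truncation in `edgeRank`, so the exponent of `0` is positive.
    have : Nat.card (fromEdgeSet (A : Set (Sym2 V))).ConnectedComponent ≤ Nat.card V :=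
      Nat.card_le_card_of_surjective _ Quot.mk_surjective
    unfold edgeRank
    omega

end SimpleGraph

theorem corollary1 {V : Type*} [Finite V] (Γ : SimpleGraph V) :
    -- if `e = {v, w}` is a bridge linking `Γ₁ = Γ[S]` and `Γ₂ = Γ[Sᶜ]`
    (∀ (v w : V) (S : Set V), Γ.Adj v w → Γ.IsBridge s(v, w) → v ∈ S → w ∉ S →
      (∀ x y, (Γ.deleteEdges {s(v, w)}).Adj x y → (x ∈ S ↔ y ∈ S)) →
      Γ.kappa = (Γ.induce S).kappa * (Γ.induce Sᶜ).kappa) ∧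
    -- if `e` is a cycle-edge
    (∀ e : Sym2 V, Γ.IsCycleEdge e →
      Γ.kappa = (Γ.deleteEdges {e}).kappa + (Γ.contractEdge e).kappa) ∧
    -- the evaluation of the Tutte polynomial
    (Γ.kappa : ℤ) = MvPolynomial.eval ![1, 0] Γ.tuttePolynomial := by
  refine ⟨fun v w S hvw hb hv hw hS => ?_, fun e => Γ.kappa_eq_add_of_isCycleEdge,
    Γ.kappa_eq_eval_tuttePolynomial⟩
  -- The ends of the bridge lie on opposite sides, so neither induced subgraph contains it.
  have hS₁ : (Γ.deleteEdges {s(v, w)}).induce S = Γ.induce S := by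
    ext ⟨x, hx⟩ ⟨y, hy⟩
    have : ¬ s(x, y) = s(v, w) := by
      rw [Sym2.eq_iff]
      rintro (⟨rfl, rfl⟩ | ⟨rfl, rfl⟩) <;> contradiction
    simp [this]
  have hS₂ : (Γ.deleteEdges {s(v, w)}).induce Sᶜ = Γ.induce Sᶜ := by
    ext ⟨x, hx⟩ ⟨y, hy⟩
    have : ¬ s(x, y) = s(v, w) := by
      rw [Sym2.eq_iff]
      rintro (⟨rfl, rfl⟩ | ⟨rfl, rfl⟩) <;> contradiction
    simp [this]
  rw [SimpleGraph.kappa_deleteEdges_of_isBridge hvw hb,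
    SimpleGraph.kappa_eq_mul_of_forall_adj hS, hS₁, hS₂]
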